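/- Let $d\ge 0$, $T\ge 1$, $L\ge 0$, $\eta>0$. Let $\ell:\mathbb{R}\times\mathbb{R}\to\mathbb{R}$ be such that $\ell(\cdot,a)$ is $L$-Lipschitz for every $a\in\mathbb{R}$, let $(x_1,y_1),(x_2,y_2),\dots\in\mathbb{R}^d\times\mathbb{R}$ be arbitrary examples, put $\ell_t(v)=\ell(v^\top x_t,y_t)$, and assume that $\ell_t$ is convex on $\mathbb{R}^d$ for $t=1,\dots,T$. For $f:\mathbb{R}^d\to\mathbb{R}$ let $f^*(\theta)=\sup_{v}\bigl(v^\top\theta-f(v)\bigr)\in(-\infty,+\infty]$. Online Mirror Descent (OMD) with regularizers $f_1,f_2,\dots$ starts from $\theta_1=0$, predicts in round $t$ with $w_t=\nabla f_t^*(\theta_t)$, receives a subgradient $\ell'_t\in\partial\ell_t(w_t)$, and sets $\theta_{t+1}=\theta_t-\eta\,\ell'_t$. (If $f_t^*$ is not differentiable at $\theta_t$, which happens if some feature was zero in rounds $1,\dots,t$, then $w_t$ may be any element of $\partial f_t^*(\theta_t)$.) Its regret against $u\in\mathbb{R}^d$ is $R_T(u)=\sum_{t=1}^T\ell_t(w_t)-\sum_{t=1}^T\ell_t(u)$.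 Write $b_{t,i}=\max_{s\le t}|x_{s,i}|$, let $m_t$ be the maximum over $s\le t$ of the number of nonzero components of $x_s$, and let $p_t=2\ln m_t$, $q_t=\frac{p_t}{p_t-1}$, and, with $0/0=0$, $$\beta_t=\sqrt{eL^2(p_t-1)+\sum_{s=1}^{t-1}(p_s-1)\Bigl(\sum_{i=1}^d\Bigl(\frac{|\ell'_{s,i}|}{b_{s,i}}\Bigr)^{p_s}\Bigr)^{2/p_s}}.$$ (1) Suppose that $q_t\in(1,2]$ for $t=1,\dots,T$ (equivalently, $x_1$ has at least three nonzero components). If OMD is run with $$f_t(u)=\frac{\beta_t}{2}\Bigl(\sum_{i=1}^d\bigl(|u_i|b_{t,i}\bigr)^{q_t}\Bigr)^{2/q_t},$$ then for every $u\in\mathbb{R}^d$ $$R_T(u)\le L\sqrt{e(T+1)(2\ln m_T-1)}\left(\frac{1}{2\eta}\Bigl(\sum_{i=1}^d|u_i|b_{T,i}\Bigr)^2+\eta\right).$$ (2) If OMD is run with $$f_t(u)=\frac{\sqrt d}{2}\sum_{i=1}^d\bigl(|u_i|b_{t,i}\bigr)^2\sqrt{L^2+\sum_{s=1}^{t-1}\Bigl(\frac{\ell'_{s,i}}{b_{s,i}}\Bigr)^2},$$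 then for every $u\in\mathbb{R}^d$ $$R_T(u)\le L\sqrt{d(T+1)}\left(\frac{1}{2\eta}\sum_{i=1}^d\bigl(u_ib_{T,i}\bigr)^2+\eta\right).$$ -/

import Mathlib

open scoped NNReal

namespace OMD

noncomputable section

/-! ### Convex analysis -/

section Convex

variable {X : Type*} [NormedAddCommGroup X] [InnerProductSpace ℝ X]

/-- The Fenchel conjugate of a function that is finite on all of `X`. It takes values in the
extended reals, since the supremum may be infinite. -/
def conjugate (f : X → ℝ) (θ : X) : EReal :=
  ⨆ v : X, ((inner ℝ v θ - f v : ℝ) : EReal)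

/-- The set of subgradients of an extended real function at a point of its domain. -/
def subdifferential (F : X → EReal) (v : X) : Set X :=
  {g | F v ≠ ⊥ ∧ F v ≠ ⊤ ∧ ∀ u : X, F v + ((inner ℝ (u - v) g : ℝ) : EReal) ≤ F u}

/-- `T` rounds of Online Mirror Descent with regularizers `f t` and inputs `z t`: the state is
`θ t` and the prediction is `w t`. The prediction is the gradient of the conjugate of `f t` at
`θ t`, see `mem_subdifferential_conjugate_iff`. It is written with the subdifferential because
`f t` may vanish along some coordinates (features that were always zero so far); then the
conjugate is infinite outside a subspace and the coordinates of `w t` orthogonal to that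
subspace are arbitrary. -/
structure IsRun (f : ℕ → X → ℝ) (z : ℕ → X) (T : ℕ) (θ w : ℕ → X) : Prop where
  init : θ 1 = 0
  predict : ∀ t ∈ Finset.Icc 1 T, w t ∈ subdifferential (conjugate (f t)) (θ t)
  update : ∀ t ∈ Finset.Icc 1 T, θ (t + 1) = θ t + z t

/-- Where a finite conjugate is differentiable, its only subgradient is its gradient. -/
theorem mem_subdifferential_conjugate_iff [CompleteSpace X] {f F : X → ℝ} {θ g w : X}
    (hF : ∀ v, conjugate f v = (F v : EReal)) (hg : HasGradientAt F g θ) :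
    w ∈ subdifferential (conjugate f) θ ↔ w = g := by
  have key : w ∈ subdifferential (conjugate f) θ ↔ ∀ u, F θ + inner ℝ (u - θ) w ≤ F u := by
    simp only [subdifferential, Set.mem_ofPred_eq, hF]
    constructor
    · rintro ⟨-, -, h⟩ u
      exact_mod_cast h u
    · intro h
      exact ⟨EReal.coe_ne_bot _, EReal.coe_ne_top _, fun u => by exact_mod_cast h u⟩
  have hline : ∀ h : X, HasDerivAt (fun s : ℝ => F (θ + s • h)) (inner ℝ g h) 0 := by
    intro h
    have h1 : HasDerivAt (fun s : ℝ => θ + s • h) h 0 := by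
      simpa using ((hasDerivAt_id (0 : ℝ)).smul_const h).const_add θ
    have h2 : HasFDerivAt F (InnerProductSpace.toDual ℝ X g) (θ + (0 : ℝ) • h) := by
      simpa using hg.hasFDerivAt
    have h3 := h2.comp_hasDerivAt (0 : ℝ) h1
    rw [InnerProductSpace.toDual_apply_apply] at h3
    exact h3
  rw [key]
  constructor
  · intro hw
    have h0 : HasDerivAt (fun s : ℝ => F (θ + s • (w - g)) - s * inner ℝ (w - g) w)
        (inner ℝ g (w - g) - inner ℝ (w - g) w) 0 := by
      have h3 := (hline (w - g)).sub ((hasDerivAt_id (0 : ℝ)).mul_const (inner ℝ (w - g) w))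
      rw [one_mul] at h3
      exact h3
    have hmin : IsLocalMin (fun s : ℝ => F (θ + s • (w - g)) - s * inner ℝ (w - g) w) 0 := by
      refine Filter.Eventually.of_forall fun s => ?_
      have := hw (θ + s • (w - g))
      simp only [add_sub_cancel_left, inner_smul_left] at this
      simp at this ⊢
      linarith
    have h1 := hmin.hasDerivAt_eq_zero h0
    rw [real_inner_comm, ← inner_sub_right] at h1
    have h2 : inner ℝ (w - g) (w - g) = (0 : ℝ) := by
      rw [← neg_sub w g, inner_neg_right] at h1
      linarith
    exact sub_eq_zero.mp (inner_self_eq_zero.mp h2)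
  · rintro rfl u
    have hle : ∀ v η : X, inner ℝ v η - f v ≤ F η := fun v η => by
      have : ((inner ℝ v η - f v : ℝ) : EReal) ≤ conjugate f η :=
        le_iSup (fun v : X => ((inner ℝ v η - f v : ℝ) : EReal)) v
      rw [hF] at this
      exact_mod_cast this
    have hconv : ConvexOn ℝ Set.univ F := by
      refine ⟨convex_univ, fun p _ r _ a b ha hb hab => ?_⟩
      have : conjugate f (a • p + b • r) ≤ ((a * F p + b * F r : ℝ) : EReal) := by
        refine iSup_le fun v => ?_
        have h1 := mul_le_mul_of_nonneg_left (hle v p) ha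
        have h2 := mul_le_mul_of_nonneg_left (hle v r) hb
        have h3 : f v = a * f v + b * f v := by rw [← add_mul, hab, one_mul]
        rw [inner_add_right, inner_smul_right, inner_smul_right]
        exact_mod_cast (by linarith)
      rw [hF] at this
      simpa using (by exact_mod_cast this : F (a • p + b • r) ≤ a * F p + b * F r)
    have hc : ConvexOn ℝ Set.univ (fun s : ℝ => F (θ + s • (u - θ))) := by
      have := hconv.comp_affineMap (AffineMap.lineMap (k := ℝ) θ u)
      simpa [Function.comp_def, AffineMap.lineMap_apply, add_comm] using this
    have h1 := hc.le_slope_of_hasDerivAt (x := 0) (y := 1) (Set.mem_univ _) (Set.mem_univ _)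
      one_pos (hline (u - θ))
    simp [slope_def_field] at h1
    rw [real_inner_comm]
    linarith

end Convex

/-! ### Online prediction with linear predictors -/

section Linear

variable {d : ℕ}

/-- The loss of the linear predictor `v` in round `t`, on the example `(x t, y t)`. -/
def loss (ℓ : ℝ → ℝ → ℝ) (x : ℕ → EuclideanSpace ℝ (Fin d)) (y : ℕ → ℝ) (t : ℕ)
    (v : EuclideanSpace ℝ (Fin d)) : ℝ :=
  ℓ (inner ℝ v (x t)) (y t)

/-- The regret after `T` rounds of the predictions `w` against `u`. -/
def regret (ℓ : ℝ → ℝ → ℝ) (x : ℕ → EuclideanSpace ℝ (Fin d)) (y : ℕ → ℝ)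
    (w : ℕ → EuclideanSpace ℝ (Fin d)) (T : ℕ) (u : EuclideanSpace ℝ (Fin d)) : ℝ :=
  ∑ t ∈ Finset.Icc 1 T, loss ℓ x y t (w t) - ∑ t ∈ Finset.Icc 1 T, loss ℓ x y t u

/-- The largest absolute value of feature `i` in rounds `1, …, t`. -/
def b (x : ℕ → EuclideanSpace ℝ (Fin d)) (t : ℕ) (i : Fin d) : ℝ :=
  (((Finset.Icc 1 t).sup fun s => ‖x s i‖₊ : ℝ≥0) : ℝ)

/-- The largest number of nonzero features of an example in rounds `1, …, t`. -/
def m (x : ℕ → EuclideanSpace ℝ (Fin d)) (t : ℕ) : ℕ :=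
  (Finset.Icc 1 t).sup fun s => (Finset.univ.filter fun i => x s i ≠ 0).card

/-- The dual exponent. -/
def p (x : ℕ → EuclideanSpace ℝ (Fin d)) (t : ℕ) : ℝ :=
  2 * Real.log (m x t)

/-- The exponent of the weighted norm. -/
def q (x : ℕ → EuclideanSpace ℝ (Fin d)) (t : ℕ) : ℝ :=
  p x t / (p x t - 1)

/-- The scaling factor of the first regularizer; `g s` is the subgradient of round `s`, and a
ratio `0 / 0` is read as `0`. -/
def β (L : ℝ) (x g : ℕ → EuclideanSpace ℝ (Fin d)) (t : ℕ) : ℝ :=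
  √(Real.exp 1 * L ^ 2 * (p x t - 1) +
    ∑ s ∈ Finset.Ico 1 t, (p x s - 1) * (∑ i, (|g s i| / b x s i) ^ p x s) ^ (2 / p x s))

/-- The regularizer based on the weighted `q`-norm. -/
def reg₁ (L : ℝ) (x g : ℕ → EuclideanSpace ℝ (Fin d)) (t : ℕ)
    (u : EuclideanSpace ℝ (Fin d)) : ℝ :=
  β L x g t / 2 * (∑ i, (|u i| * b x t i) ^ q x t) ^ (2 / q x t)

/-- The regularizer with a learning rate for each coordinate. -/
def reg₂ (L : ℝ) (x g : ℕ → EuclideanSpace ℝ (Fin d)) (t : ℕ)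
    (u : EuclideanSpace ℝ (Fin d)) : ℝ :=
  √(d : ℝ) / 2 *
    ∑ i, (|u i| * b x t i) ^ 2 * √(L ^ 2 + ∑ s ∈ Finset.Ico 1 t, (g s i / b x s i) ^ 2)

end Linear

end

end OMD

/-! The subgradient inequality replaces the regret by the linear sum of `⟪u - w t, -(η • g t)⟫`,
which `IsRun.sum_inner_le` bounds by following the conjugates `f_t^*` along the states. Smoothness
gives `f_t^*(θ_{t+1}) ≤ f_t^*(θ_t) + ⟪w_t, z_t⟫ + c_t`, growing regularizers give `f_{t+1}^* ≤
f_t^*`, and Fenchel-Young at `u` closes the chain with `f_T(u) + ∑ c_t`. The conjugates may be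
infinite off a subspace, so smoothness is only asked along the line `θ_t + s z_t`, which stays in
the domain because `θ_t` and `g_t` vanish wherever `b_t` does.

For the first regularizer, `f_t^*` is `‖θ / b_t‖_p ^ 2 / (2 β_t)`, and `Real.concaveOn_sum_rpow_sub`
yields `c_t = η² A_t / (2 β_t)` with `A_t = (p_t - 1) ‖g_t / b_t‖_p ^ 2`. Since `|g_{t,i}| ≤ L
|x_{t,i}|` and at most `m_t` features are active, `A_t ≤ K_t := e L² (p_t - 1)`. As `β_t² = K_t +
∑_{s<t} A_s`, `Finset.sum_div_sqrt_le` bounds `∑ A_t / β_t` by `2 √(∑ A_t)`. The second regularizer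
is handled in the same way, one coordinate at a time. -/

theorem Real.hasDerivAt_abs_rpow_mul_self {p : ℝ} (hp : 2 < p) (u : ℝ) :
    HasDerivAt (fun u : ℝ => |u| ^ (p - 2) * u) ((p - 1) * |u| ^ (p - 2)) u := by
  rcases eq_or_ne u 0 with rfl | hu
  -- At the origin the difference quotient is `|v| ^ (p - 2)` itself, which tends to `0` because `p
  -- > 2`.
  · have h0 : |(0 : ℝ)| ^ (p - 2) = 0 := by
      rw [abs_zero, Real.zero_rpow (by linarith)]
    rw [h0, mul_zero, hasDerivAt_iff_tendsto_slope]
    have hc : Continuous (fun u : ℝ => |u| ^ (p - 2)) :=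
      continuous_abs.rpow_const fun _ => Or.inr (by linarith)
    have ht := (hc.tendsto 0).mono_left (nhdsWithin_le_nhds (s := {0}ᶜ))
    rw [h0] at ht
    refine ht.congr' ?_
    filter_upwards [self_mem_nhdsWithin] with v hv
    have hv : v ≠ 0 := hv
    simp [slope_def_field, hv]
  · have h1 : HasDerivAt (fun u : ℝ => |u| ^ (p - 2))
        (SignType.sign u * (p - 2) * |u| ^ (p - 2 - 1)) u :=
      (hasDerivAt_abs hu).rpow_const (Or.inl (abs_ne_zero.mpr hu))
    have h2 := h1.mul (hasDerivAt_id u)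
    refine h2.congr_deriv ?_
    rw [Real.rpow_sub_one (abs_ne_zero.mpr hu)]
    have h3 : (SignType.sign u : ℝ) * u = |u| := sign_mul_self u
    have h4 : (0 : ℝ) < |u| := abs_pos.mpr hu
    simp only [id_eq, mul_one]
    calc (SignType.sign u : ℝ) * (p - 2) * (|u| ^ (p - 2) / |u|) * u + |u| ^ (p - 2)
        = (SignType.sign u : ℝ) * u * (p - 2) * (|u| ^ (p - 2) / |u|) + |u| ^ (p - 2) := by ring
      _ = _ := by rw [h3]; field_simp; ring

/-! ### Inequalities for `ℓ^p` norms -/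

section Lp

variable {ι : Type*} [Fintype ι]

/-- Split `c ^ r = c * c ^ (r - 1)` and bound the second factor using `c i ≤ ∑ c`. -/
theorem Real.sum_rpow_le_rpow_sum {r : ℝ} (hr : 1 ≤ r) {c : ι → ℝ} (hc : ∀ i, 0 ≤ c i) :
    ∑ i, c i ^ r ≤ (∑ i, c i) ^ r := by
  have hS : 0 ≤ ∑ i, c i := Finset.sum_nonneg fun i _ => hc i
  have key : ∀ a : ℝ, 0 ≤ a → a ^ r = a * a ^ (r - 1) := fun a ha => by
    conv_lhs => rw [show r = 1 + (r - 1) by ring]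
    rw [Real.rpow_add_of_nonneg ha one_pos.le (by linarith), Real.rpow_one]
  rw [key _ hS, Finset.sum_mul]
  refine Finset.sum_le_sum fun i _ => ?_
  rw [key _ (hc i)]
  exact mul_le_mul_of_nonneg_left (Real.rpow_le_rpow (hc i)
    (Finset.single_le_sum (fun j _ => hc j) (Finset.mem_univ i)) (by linarith)) (hc i)

/-- The squared `ℓ^q` norm is antitone in the exponent. -/
theorem Real.sum_rpow_rpow_antitone {q r : ℝ} (hq : 0 < q) (hqr : q ≤ r) {a : ι → ℝ}
    (ha : ∀ i, 0 ≤ a i) : (∑ i, a i ^ r) ^ (2 / r) ≤ (∑ i, a i ^ q) ^ (2 / q) := by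
  have hr : 0 < r := hq.trans_le hqr
  have h1 : ∑ i, a i ^ r ≤ (∑ i, a i ^ q) ^ (r / q) := by
    have := Real.sum_rpow_le_rpow_sum ((one_le_div hq).mpr hqr)
      (fun i => Real.rpow_nonneg (ha i) q)
    refine le_trans (le_of_eq (Finset.sum_congr rfl fun i _ => ?_)) this
    rw [← Real.rpow_mul (ha i), mul_div_cancel₀ _ hq.ne']
  refine (Real.rpow_le_rpow (Finset.sum_nonneg fun i _ => Real.rpow_nonneg (ha i) r) h1
    (by positivity)).trans_eq ?_
  rw [← Real.rpow_mul (Finset.sum_nonneg fun i _ => Real.rpow_nonneg (ha i) q)]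
  congr 1
  field_simp

/-- Second order smoothness of the squared `ℓ^p` norm along a line. -/
theorem Real.concaveOn_sum_rpow_sub {p : ℝ} (hp : 2 < p) (x z : ι → ℝ) :
    ConcaveOn ℝ Set.univ (fun s : ℝ => (∑ i, |x i + s * z i| ^ p) ^ (2 / p) -
      (p - 1) * (∑ i, |z i| ^ p) ^ (2 / p) * s ^ 2) := by
  have hp0 : 0 < p := by linarith
  set Z := ∑ i, |z i| ^ p with hZ
  have hZ0 : 0 ≤ Z := Finset.sum_nonneg fun i _ => by positivity
  set h : ℝ → ℝ := fun s => ∑ i, |x i + s * z i| ^ p with hh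
  have hh0 : ∀ s, 0 ≤ h s := fun s => Finset.sum_nonneg fun i _ => by positivity
  change ConcaveOn ℝ Set.univ (fun s : ℝ => h s ^ (2 / p) - (p - 1) * Z ^ (2 / p) * s ^ 2)
  -- If the line meets the origin, then `x = -s₀ z` and the squared norm is exactly quadratic.
  -- Otherwise `h > 0` throughout and its powers can be differentiated twice.
  by_cases hz : ∃ s₀, h s₀ = 0
  · obtain ⟨s₀, hs₀⟩ := hz
    have hx : ∀ i, x i = -(s₀ * z i) := fun i => by
      have := (Finset.sum_eq_zero_iff_of_nonneg (fun i _ => by positivity)).mp hs₀ i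
        (Finset.mem_univ i)
      rw [Real.rpow_eq_zero (abs_nonneg _) hp0.ne', abs_eq_zero] at this
      linarith
    have hval : ∀ s, h s ^ (2 / p) = (s - s₀) ^ 2 * Z ^ (2 / p) := fun s => by
      have : h s = |s - s₀| ^ p * Z := by
        rw [hh, hZ, Finset.mul_sum]
        refine Finset.sum_congr rfl fun i _ => ?_
        rw [← Real.mul_rpow (abs_nonneg _) (abs_nonneg _), ← abs_mul, hx]
        congr 2; ring
      rw [this, Real.mul_rpow (by positivity) hZ0, ← Real.rpow_mul (abs_nonneg _),
        mul_div_cancel₀ _ hp0.ne', Real.rpow_two, sq_abs]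
    simp only [hval]
    have hW : 0 ≤ Z ^ (2 / p) := by positivity
    refine ⟨convex_univ, fun s _ r _ α γ hα hγ hαγ => ?_⟩
    simp only [smul_eq_mul]
    obtain rfl : γ = 1 - α := by linarith
    -- The concavity gap of a quadratic with leading coefficient `-(p - 2) Z ^ (2 / p)`.
    have : 0 ≤ (p - 2) * Z ^ (2 / p) * (α * (1 - α) * (s - r) ^ 2) := by
      have : 0 ≤ p - 2 := by linarith
      positivity
    nlinarith [this]
  · push Not at hz
    have hpos : ∀ s, 0 < h s := fun s => (hh0 s).lt_of_ne' (hz s)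
    set K : ℝ → ℝ := fun s => ∑ i, |x i + s * z i| ^ (p - 2) * (x i + s * z i) * z i with hK
    set J : ℝ → ℝ := fun s => ∑ i, |x i + s * z i| ^ (p - 2) * z i ^ 2 with hJ
    have hlin : ∀ i s, HasDerivAt (fun s => x i + s * z i) (z i) s := fun i s => by
      simpa using ((hasDerivAt_id s).mul_const (z i)).const_add (x i)
    have dh : ∀ s, HasDerivAt h (p * K s) s := fun s => by
      rw [hK, Finset.mul_sum]
      refine HasDerivAt.fun_sum fun i _ => ?_
      have := (hasDerivAt_abs_rpow (x i + s * z i) (by linarith : 1 < p)).comp s (hlin i s)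
      exact this.congr_deriv (by ring)
    have dK : ∀ s, HasDerivAt K ((p - 1) * J s) s := fun s => by
      rw [hJ, Finset.mul_sum]
      refine HasDerivAt.fun_sum fun i _ => ?_
      have := ((Real.hasDerivAt_abs_rpow_mul_self hp (x i + s * z i)).comp s (hlin i s)).mul_const
        (z i)
      exact this.congr_deriv (by ring)
    have d1 : ∀ s, HasDerivAt (fun s : ℝ => h s ^ (2 / p) - (p - 1) * Z ^ (2 / p) * s ^ 2)
        (2 * (h s ^ (2 / p - 1) * K s) - (p - 1) * Z ^ (2 / p) * (2 * s)) s := fun s => by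
      have h1 := (dh s).rpow_const (p := 2 / p) (Or.inl (hz s))
      have h2 := (((hasDerivAt_id s).pow 2).const_mul ((p - 1) * Z ^ (2 / p)))
      refine (h1.sub h2).congr_deriv ?_
      simp
      field_simp
    have d2 : ∀ s, HasDerivAt
        (fun s => 2 * (h s ^ (2 / p - 1) * K s) - (p - 1) * Z ^ (2 / p) * (2 * s))
        (2 * (p * K s * (2 / p - 1) * h s ^ (2 / p - 1 - 1) * K s +
          h s ^ (2 / p - 1) * ((p - 1) * J s)) - (p - 1) * Z ^ (2 / p) * 2) s := fun s => by
      have h1 := (((dh s).rpow_const (p := 2 / p - 1) (Or.inl (hz s))).mul (dK s)).const_mul 2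
      have h2 := (((hasDerivAt_id s).const_mul 2).const_mul ((p - 1) * Z ^ (2 / p)))
      exact (h1.sub h2).congr_deriv (by simp)
    have e1 : deriv (fun s : ℝ => h s ^ (2 / p) - (p - 1) * Z ^ (2 / p) * s ^ 2) =
        fun s => 2 * (h s ^ (2 / p - 1) * K s) - (p - 1) * Z ^ (2 / p) * (2 * s) :=
      funext fun s => (d1 s).deriv
    refine concaveOn_of_deriv2_nonpos' convex_univ
      (fun s _ => (d1 s).differentiableAt.differentiableWithinAt) ?_ fun s _ => ?_
    · rw [e1]
      exact fun s _ => (d2 s).differentiableAt.differentiableWithinAt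
    · rw [Function.iterate_succ, Function.iterate_one, Function.comp_apply, e1, (d2 s).deriv]
      -- Hölder with exponents `p / (p - 2)` and `p / 2`; the power of `h` cancels the factor `h ^
      -- (2 / p - 1)` in the second derivative.
      have hJZ : J s ≤ h s ^ ((p - 2) / p) * Z ^ (2 / p) := by
        have hc : (p / (p - 2)).HolderConjugate (p / 2) := by
          rw [Real.holderConjugate_iff]
          constructor
          · rw [lt_div_iff₀ (by linarith)]; linarith
          · field_simp; ring
        have := Real.inner_le_Lp_mul_Lq_of_nonneg Finset.univ hc
          (f := fun i => |x i + s * z i| ^ (p - 2)) (g := fun i => z i ^ 2)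
          (fun i _ => by positivity) (fun i _ => by positivity)
        refine this.trans_eq ?_
        have f1 : ∀ i, (|x i + s * z i| ^ (p - 2)) ^ (p / (p - 2)) = |x i + s * z i| ^ p :=
          fun i => by
            rw [← Real.rpow_mul (abs_nonneg _), mul_div_cancel₀ _ (by linarith)]
        have f2 : ∀ i, (z i ^ 2) ^ (p / 2) = |z i| ^ p := fun i => by
          rw [← sq_abs, ← Real.rpow_two, ← Real.rpow_mul (abs_nonneg _),
            mul_div_cancel₀ _ two_ne_zero]
        simp only [f1, f2, one_div, inv_div, hh, hZ]
      -- The term in `K ^ 2` has the favourable sign since `2 / p < 1`, so only the term in `J`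
      -- matters.
      have hneg : p * K s * (2 / p - 1) * h s ^ (2 / p - 1 - 1) * K s ≤ 0 := by
        have e : p * K s * (2 / p - 1) * h s ^ (2 / p - 1 - 1) * K s =
            -((p - 2) * h s ^ (2 / p - 1 - 1) * K s ^ 2) := by field_simp; ring
        have : 0 < p - 2 := by linarith
        have := Real.rpow_nonneg (hh0 s) (2 / p - 1 - 1)
        rw [e, neg_nonpos]
        positivity
      have hmul : h s ^ (2 / p - 1) * J s ≤ Z ^ (2 / p) := by
        refine (mul_le_mul_of_nonneg_left hJZ (Real.rpow_nonneg (hh0 s) _)).trans_eq ?_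
        rw [← mul_assoc, ← Real.rpow_add (hpos s)]
        have : 2 / p - 1 + (p - 2) / p = 0 := by field_simp; ring
        rw [this, Real.rpow_zero, one_mul]
      have := mul_le_mul_of_nonneg_left hmul (by linarith : 0 ≤ p - 1)
      linarith

end Lp

/-! ### Two scalar lemmas: concave functions and adaptive rates -/

/-- A concave function that vanishes at the origin and is bounded below by `-c s ^ 2` is
nonpositive. -/
theorem ConcaveOn.nonpos_of_neg_sq_le {k : ℝ → ℝ} (hk : ConcaveOn ℝ Set.univ k) (h0 : k 0 = 0)
    {c : ℝ} (hc : ∀ s, -(c * s ^ 2) ≤ k s) (s : ℝ) : k s ≤ 0 := by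
  -- The origin is a convex combination of `-ε s` and `s`, so `k (-ε s) + ε k s ≤ 0`. The lower
  -- bound at `-ε s` is of order `ε ^ 2`, hence `k s = O(ε)`.
  have key : ∀ ε : ℝ, 0 < ε → k s ≤ c * s ^ 2 * ε := fun ε hε => by
    have h1 := hk.2 (Set.mem_univ (-ε * s)) (Set.mem_univ s)
      (show 0 ≤ 1 / (1 + ε) by positivity) (show 0 ≤ ε / (1 + ε) by positivity) (by field_simp)
    have e : (1 / (1 + ε)) • (-ε * s) + (ε / (1 + ε)) • s = 0 := by
      simp only [smul_eq_mul]; field_simp; ring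
    rw [e, h0] at h1
    simp only [smul_eq_mul] at h1
    have h2 : k (-ε * s) + ε * k s ≤ 0 := by
      have : 1 / (1 + ε) * k (-ε * s) + ε / (1 + ε) * k s = (k (-ε * s) + ε * k s) / (1 + ε) := by
        field_simp
      rw [this, div_le_iff₀ (by positivity), zero_mul] at h1
      exact h1
    refine le_of_mul_le_mul_left ?_ hε
    linarith [hc (-ε * s), show c * (-ε * s) ^ 2 = ε * (c * s ^ 2 * ε) by ring]
  have hlim : Filter.Tendsto (fun ε : ℝ => c * s ^ 2 * ε) (nhdsWithin 0 (Set.Ioi 0)) (nhds 0) := by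
    have : Continuous (fun ε : ℝ => c * s ^ 2 * ε) := by fun_prop
    simpa using (this.tendsto 0).mono_left nhdsWithin_le_nhds
  exact ge_of_tendsto hlim (Filter.eventually_of_mem self_mem_nhdsWithin key)

/-- The self-bounding sum behind adaptive learning rates. -/
theorem Finset.sum_div_sqrt_le (a K : ℕ → ℝ) (T : ℕ) (ha : ∀ t ∈ Finset.Icc 1 T, 0 ≤ a t)
    (hK : ∀ t ∈ Finset.Icc 1 T, a t ≤ K t) :
    ∑ t ∈ Finset.Icc 1 T, a t / √(K t + ∑ s ∈ Finset.Ico 1 t, a s) ≤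
      2 * √(∑ t ∈ Finset.Icc 1 T, a t) := by
  induction T with
  | zero => simp
  | succ T ih =>
    have hsub : Finset.Icc 1 T ⊆ Finset.Icc 1 (T + 1) := Finset.Icc_subset_Icc_right (by omega)
    have ih := ih (fun t ht => ha t (hsub ht)) (fun t ht => hK t (hsub ht))
    rw [Finset.sum_Icc_succ_top (by omega), Finset.sum_Icc_succ_top (by omega)]
    have hI : Finset.Ico 1 (T + 1) = Finset.Icc 1 T := rfl
    rw [hI]
    set S := ∑ t ∈ Finset.Icc 1 T, a t
    have hS : 0 ≤ S := Finset.sum_nonneg fun t ht => ha t (hsub ht)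
    have hm : T + 1 ∈ Finset.Icc 1 (T + 1) := by simp
    have hA := ha _ hm
    have hKA := hK _ hm
    -- A zero term is set aside because `S + a (T + 1)` may then vanish.
    rcases hA.eq_or_lt with h0 | h0
    · rw [← h0]; simpa using ih
    · have h1 : a (T + 1) / √(K (T + 1) + S) ≤ a (T + 1) / √(S + a (T + 1)) := 
        div_le_div_of_nonneg_left hA (Real.sqrt_pos.mpr (by linarith))
          (Real.sqrt_le_sqrt (by linarith))
      -- Factor `a` as a difference of squares of the two roots, whose sum is at most `2 √(S + a)`;
      -- the right side telescopes.
      have h2 : a (T + 1) / √(S + a (T + 1)) ≤ 2 * (√(S + a (T + 1)) - √S) := by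
        have hp : 0 < √(S + a (T + 1)) := Real.sqrt_pos.mpr (by linarith)
        rw [div_le_iff₀ hp]
        nlinarith [Real.sq_sqrt hS, Real.sq_sqrt (by linarith : 0 ≤ S + a (T + 1)),
          sq_nonneg (√(S + a (T + 1)) - √S)]
      linarith

namespace OMD

/-! ### Conjugates and the general mirror descent bound -/

section Convex

variable {X : Type*} [NormedAddCommGroup X] [InnerProductSpace ℝ X]

theorem le_conjugate (f : X → ℝ) (v θ : X) : ((inner ℝ v θ - f v : ℝ) : EReal) ≤ conjugate f θ :=
  le_iSup (fun v : X => ((inner ℝ v θ - f v : ℝ) : EReal)) v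

theorem conjugate_anti {f h : X → ℝ} (hfh : ∀ v, f v ≤ h v) (θ : X) :
    conjugate h θ ≤ conjugate f θ :=
  iSup_mono fun v => by exact_mod_cast sub_le_sub_left (hfh v) _

theorem conjugate_eq_of_le_of_eq {f : X → ℝ} {θ : X} {r : ℝ} (hle : ∀ v, inner ℝ v θ - f v ≤ r)
    {v : X} (hv : r ≤ inner ℝ v θ - f v) : conjugate f θ = r :=
  le_antisymm (iSup_le fun v => by exact_mod_cast hle v)
    (le_trans (by exact_mod_cast hv) (le_conjugate f v θ))

/-- A function that is smooth along a line satisfies the descent inequality at every subgradient,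
even if it is not differentiable in other directions. -/
theorem le_of_mem_subdifferential_of_concaveOn {F : X → EReal} {θ z w : X}
    (hw : w ∈ subdifferential F θ) {φ : ℝ → ℝ} (hφ : ∀ s : ℝ, F (θ + s • z) = φ s) {c : ℝ}
    (hc : ConcaveOn ℝ Set.univ (fun s => φ s - c * s ^ 2)) :
    φ 1 ≤ φ 0 + inner ℝ w z + c := by
  have hsub : ∀ s : ℝ, φ 0 + s * inner ℝ w z ≤ φ s := fun s => by
    have h := hw.2.2 (θ + s • z)
    have h0 := hφ 0
    rw [zero_smul, add_zero] at h0
    rw [h0, hφ, add_sub_cancel_left, real_inner_smul_left, real_inner_comm] at h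
    exact_mod_cast h
  have haff : ConcaveOn ℝ Set.univ (fun s : ℝ => -φ 0 - s * inner ℝ w z) :=
    ⟨convex_univ, fun s _ r _ a b _ _ hab => le_of_eq (by
      obtain rfl : b = 1 - a := by linarith
      simp only [smul_eq_mul]; ring)⟩
  -- Subtract from `φ - c s ^ 2` the supporting line given by `w`. The result is concave, vanishes
  -- at `0` and is at least `-c s ^ 2`, hence nonpositive; no derivative of `φ` is used.
  have := (hc.add haff).nonpos_of_neg_sq_le (by simp) (c := c)
    (fun s => by simp only [Pi.add_apply]; linarith [hsub s]) 1
  simp only [Pi.add_apply] at this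
  linarith

/-- The regret bound of Online Mirror Descent with increasing regularizers, for linear losses. -/
theorem IsRun.sum_inner_le {f : ℕ → X → ℝ} {z θ w : ℕ → X} {T : ℕ} (hT : 1 ≤ T)
    (h : IsRun f z T θ w) (hpos : ∀ u, 0 ≤ f 1 u)
    (hmono : ∀ t ∈ Finset.Ico 1 T, ∀ u, f t u ≤ f (t + 1) u) {c : ℕ → ℝ}
    (hsmooth : ∀ t ∈ Finset.Icc 1 T, ∃ φ : ℝ → ℝ,
      (∀ s : ℝ, conjugate (f t) (θ t + s • z t) = φ s) ∧
      ConcaveOn ℝ Set.univ (fun s => φ s - c t * s ^ 2)) (u : X) :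
    ∑ t ∈ Finset.Icc 1 T, inner ℝ (u - w t) (z t) ≤ f T u + ∑ t ∈ Finset.Icc 1 T, c t := by
  -- The real bound `r` keeps the recursion free of extended real arithmetic.
  have step : ∀ t ∈ Finset.Icc 1 T, ∀ r : ℝ, conjugate (f t) (θ t) ≤ r →
      conjugate (f t) (θ (t + 1)) ≤ ((r + (inner ℝ (w t) (z t) + c t) : ℝ) : EReal) := by
    intro t ht r hr
    obtain ⟨φ, hφ, hc⟩ := hsmooth t ht
    have h1 := le_of_mem_subdifferential_of_concaveOn (h.predict t ht) hφ hc
    have h0 := hφ 0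
    have e1 := hφ 1
    rw [zero_smul, add_zero] at h0
    rw [one_smul, ← h.update t ht] at e1
    rw [h0] at hr
    have hr : φ 0 ≤ r := by exact_mod_cast hr
    rw [e1]
    exact_mod_cast (by linarith)
  have main : ∀ t, 1 ≤ t → t ≤ T → conjugate (f t) (θ (t + 1)) ≤
      ((∑ s ∈ Finset.Icc 1 t, (inner ℝ (w s) (z s) + c s) : ℝ) : EReal) := by
    intro t ht
    induction t, ht using Nat.le_induction with
    | base =>
      intro _
      have h0 : conjugate (f 1) (θ 1) ≤ ((0 : ℝ) : EReal) := by
        rw [h.init]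
        refine iSup_le fun v => ?_
        rw [inner_zero_right]
        exact_mod_cast (by linarith [hpos v])
      simpa using step 1 (by simpa using hT) 0 h0
    | succ t ht ih =>
      intro htT
      have h1 := (conjugate_anti (hmono t (by simp; omega)) (θ (t + 1))).trans (ih (by omega))
      rw [Finset.sum_Icc_succ_top (by omega)]
      exact step (t + 1) (by simp; omega) _ h1
  have hθ : ∀ t, t ≤ T → θ (t + 1) = ∑ s ∈ Finset.Icc 1 t, z s := by
    intro t
    induction t with
    | zero => intro _; simpa using h.init
    | succ t ih =>
      intro htT
      rw [Finset.sum_Icc_succ_top (by omega), ← ih (by omega)]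
      exact h.update (t + 1) (by simp; omega)
  -- Fenchel-Young at the comparator.
  have h1 := (le_conjugate (f T) u (θ (T + 1))).trans (main T hT le_rfl)
  have h1 : inner ℝ u (θ (T + 1)) - f T u ≤
      ∑ s ∈ Finset.Icc 1 T, (inner ℝ (w s) (z s) + c s) := by exact_mod_cast h1
  rw [hθ T le_rfl, inner_sum, Finset.sum_add_distrib] at h1
  simp only [inner_sub_left, Finset.sum_sub_distrib]
  linarith

end Convex

/-! ### Conjugates of the two regularizers -/

section Conjugates

variable {d : ℕ}

theorem inner_eq_sum (u v : EuclideanSpace ℝ (Fin d)) : inner ℝ u v = ∑ i, u i * v i := by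
  simp [PiLp.inner_apply, mul_comm]

/-- The coordinates decouple, and each is maximized at `θ i / (2 * a i)`. Where `a i = 0`, the
condition on `θ` makes the term zero, in agreement with `0 / 0 = 0`. -/
theorem conjugate_weighted_sq {a : Fin d → ℝ} (ha : ∀ i, 0 ≤ a i) {θ : EuclideanSpace ℝ (Fin d)}
    (hθ : ∀ i, a i = 0 → θ i = 0) :
    conjugate (fun u : EuclideanSpace ℝ (Fin d) => ∑ i, a i * u i ^ 2) θ =
      ((∑ i, θ i ^ 2 / (4 * a i) : ℝ) : EReal) := by
  refine conjugate_eq_of_le_of_eq (v := WithLp.toLp 2 fun i => θ i / (2 * a i)) (fun v => ?_) ?_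
  · rw [inner_eq_sum, ← Finset.sum_sub_distrib]
    refine Finset.sum_le_sum fun i _ => ?_
    rcases (ha i).eq_or_lt with h | h
    · rw [hθ i h.symm, ← h]; simp
    · rw [le_div_iff₀ (by positivity)]
      nlinarith [sq_nonneg (2 * a i * v i - θ i)]
  · rw [inner_eq_sum, ← Finset.sum_sub_distrib]
    refine Finset.sum_le_sum fun i _ => le_of_eq ?_
    rcases (ha i).eq_or_lt with h | h
    · rw [hθ i h.symm, ← h]; simp
    · simp only
      field_simp
      ring

/-- The upper bound is Hölder followed by `N M ≤ β M² / 2 + N² / (2 β)`, and it is attained by a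
vector extremal for Hölder. -/
theorem conjugate_weighted_lp {p q β : ℝ} (hpq : p.HolderConjugate q) (hβ : 0 < β)
    {b : Fin d → ℝ} (hb : ∀ i, 0 ≤ b i) {θ : EuclideanSpace ℝ (Fin d)}
    (hθ : ∀ i, b i = 0 → θ i = 0) :
    conjugate (fun u : EuclideanSpace ℝ (Fin d) =>
        β / 2 * (∑ i, (|u i| * b i) ^ q) ^ (2 / q)) θ =
      (((∑ i, (|θ i| / b i) ^ p) ^ (2 / p) / (2 * β) : ℝ) : EReal) := by
  have hq := hpq.symm.pos
  have hsq : ∀ {r S : ℝ}, 0 ≤ S → S ^ (2 / r) = (S ^ (1 / r)) ^ 2 := fun {r S} hS => by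
    rw [← Real.rpow_two, ← Real.rpow_mul hS]; congr 1; ring
  set N := (∑ i, (|θ i| / b i) ^ p) ^ (1 / p) with hN
  have hS : 0 ≤ ∑ i, (|θ i| / b i) ^ p :=
    Finset.sum_nonneg fun i _ => Real.rpow_nonneg (div_nonneg (abs_nonneg _) (hb i)) _
  have hN0 : 0 ≤ N := Real.rpow_nonneg hS _
  rw [hsq hS, ← hN]
  -- A nonnegative `γ` in the `ℓ^q` unit ball that attains the dual norm `N`.
  obtain ⟨⟨γ, hγ, hγN⟩, -⟩ := NNReal.isGreatest_Lp Finset.univ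
    (fun i => (⟨|θ i| / b i, div_nonneg (abs_nonneg _) (hb i)⟩ : ℝ≥0)) hpq
  have hγ : ∑ i, (γ i : ℝ) ^ q ≤ 1 := by exact_mod_cast hγ
  have hγN : ∑ i, |θ i| / b i * (γ i : ℝ) = N := by
    have := congrArg ((↑) : ℝ≥0 → ℝ) hγN
    push_cast at this
    exact this
  -- The maximizer carries the signs of `θ`, undoes the weights, and has the scale `N / β` at which
  -- `N M - β M² / 2` is largest.
  refine conjugate_eq_of_le_of_eq
    (v := WithLp.toLp 2 fun i => N / β * (SignType.sign (θ i) * γ i / b i)) (fun v => ?_) ?_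
  · have hV : 0 ≤ ∑ i, (|v i| * b i) ^ q :=
      Finset.sum_nonneg fun i _ => Real.rpow_nonneg (mul_nonneg (abs_nonneg _) (hb i)) _
    rw [hsq hV]
    set M := (∑ i, (|v i| * b i) ^ q) ^ (1 / q) with hM
    have hin : inner ℝ v θ ≤ N * M := by
      have := Real.inner_le_Lp_mul_Lq_of_nonneg Finset.univ hpq
        (f := fun i => |θ i| / b i) (g := fun i => |v i| * b i)
        (fun i _ => div_nonneg (abs_nonneg _) (hb i)) (fun i _ => mul_nonneg (abs_nonneg _) (hb i))
      refine le_trans ?_ this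
      rw [inner_eq_sum]
      refine Finset.sum_le_sum fun i _ => ?_
      rcases (hb i).eq_or_lt with h | h
      · rw [hθ i h.symm, ← h]; simp
      · calc v i * θ i ≤ |v i * θ i| := le_abs_self _
          _ = |θ i| / b i * (|v i| * b i) := by rw [abs_mul]; field_simp
    have : N * M ≤ β / 2 * M ^ 2 + N ^ 2 / (2 * β) := by
      have : β / 2 * M ^ 2 + N ^ 2 / (2 * β) - N * M = (β * M - N) ^ 2 / (2 * β) := by
        field_simp; ring
      have : 0 ≤ (β * M - N) ^ 2 / (2 * β) := by positivity
      linarith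
    linarith
  · have hin : ∑ i, N / β * (SignType.sign (θ i) * γ i / b i) * θ i = N ^ 2 / β := by
      have : ∀ i, N / β * (SignType.sign (θ i) * γ i / b i) * θ i =
          N / β * (|θ i| / b i * (γ i : ℝ)) := fun i => by
        rw [← sign_mul_self (θ i)]; ring
      simp only [this]
      rw [← Finset.mul_sum, hγN]; ring
    have hnorm : (∑ i, (|N / β * (SignType.sign (θ i) * γ i / b i)| * b i) ^ q) ^ (2 / q) ≤
        (N / β) ^ 2 := by
      have hNβ : 0 ≤ N / β := by positivity
      have hle : ∑ i, (|N / β * (SignType.sign (θ i) * γ i / b i)| * b i) ^ q ≤ (N / β) ^ q := by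
        calc _ ≤ ∑ i, (N / β) ^ q * (γ i : ℝ) ^ q := by
              refine Finset.sum_le_sum fun i _ => ?_
              rw [← Real.mul_rpow hNβ (γ i).coe_nonneg]
              refine Real.rpow_le_rpow (mul_nonneg (abs_nonneg _) (hb i)) ?_ hq.le
              rw [abs_mul, abs_of_nonneg hNβ, mul_assoc]
              refine mul_le_mul_of_nonneg_left ?_ hNβ
              have hs : |(SignType.sign (θ i) : ℝ)| ≤ 1 := by
                rcases lt_trichotomy (θ i) 0 with h | h | h <;> simp [h]
              rw [abs_div, abs_mul, abs_of_nonneg (γ i).coe_nonneg, abs_of_nonneg (hb i)]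
              rcases (hb i).eq_or_lt with h | h
              · rw [← h]; simp
              · rw [div_mul_cancel₀ _ h.ne']
                exact mul_le_of_le_one_left (γ i).coe_nonneg hs
          _ ≤ (N / β) ^ q := by
              rw [← Finset.mul_sum]
              exact mul_le_of_le_one_right (Real.rpow_nonneg hNβ _) hγ
      refine (Real.rpow_le_rpow (Finset.sum_nonneg fun i _ =>
        Real.rpow_nonneg (mul_nonneg (abs_nonneg _) (hb i)) _) hle (by positivity)).trans_eq ?_
      rw [← Real.rpow_mul hNβ, mul_div_cancel₀ _ hq.ne', Real.rpow_two]
    rw [inner_eq_sum]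
    simp only [hin]
    have h1 := mul_le_mul_of_nonneg_left hnorm (by positivity : 0 ≤ β / 2)
    have h2 : N ^ 2 / β - β / 2 * (N / β) ^ 2 = N ^ 2 / (2 * β) := by field_simp; ring
    linarith

/-- Smoothness of the conjugate of a weighted sum of squares along lines in its domain. -/
theorem conjugate_weighted_sq_line {a : Fin d → ℝ} (ha : ∀ i, 0 ≤ a i)
    {θ z : EuclideanSpace ℝ (Fin d)} (hθ : ∀ i, a i = 0 → θ i = 0) (hz : ∀ i, a i = 0 → z i = 0) :
    ∃ φ : ℝ → ℝ, (∀ s : ℝ, conjugate (fun u : EuclideanSpace ℝ (Fin d) => ∑ i, a i * u i ^ 2)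
      (θ + s • z) = φ s) ∧
      ConcaveOn ℝ Set.univ (fun s => φ s - (∑ i, z i ^ 2 / (4 * a i)) * s ^ 2) := by
  refine ⟨_, fun s => conjugate_weighted_sq ha fun i hi => by simp [hθ i hi, hz i hi], ?_⟩
  -- The quadratic parts cancel exactly and leave an affine function.
  have : (fun s : ℝ => ∑ i, (θ + s • z) i ^ 2 / (4 * a i) - (∑ i, z i ^ 2 / (4 * a i)) * s ^ 2) =
      fun s => (∑ i, θ i ^ 2 / (4 * a i)) + s * ∑ i, 2 * θ i * z i / (4 * a i) := by
    funext s
    rw [Finset.sum_mul, Finset.mul_sum, ← Finset.sum_sub_distrib, ← Finset.sum_add_distrib]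
    refine Finset.sum_congr rfl fun i _ => ?_
    simp only [PiLp.add_apply, PiLp.smul_apply, smul_eq_mul]
    ring
  rw [this]
  refine ⟨convex_univ, fun s _ r _ α γ _ _ hαγ => le_of_eq ?_⟩
  obtain rfl : γ = 1 - α := by linarith
  simp only [smul_eq_mul]; ring

/-- Smoothness of the conjugate of a weighted squared `ℓ^q` norm along lines in its domain. -/
theorem conjugate_weighted_lp_line {p q β : ℝ} (hpq : p.HolderConjugate q) (hp : 2 < p)
    (hβ : 0 < β) {b : Fin d → ℝ} (hb : ∀ i, 0 ≤ b i)
    {θ z : EuclideanSpace ℝ (Fin d)} (hθ : ∀ i, b i = 0 → θ i = 0) (hz : ∀ i, b i = 0 → z i = 0) :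
    ∃ φ : ℝ → ℝ, (∀ s : ℝ, conjugate (fun u : EuclideanSpace ℝ (Fin d) =>
        β / 2 * (∑ i, (|u i| * b i) ^ q) ^ (2 / q)) (θ + s • z) = φ s) ∧
      ConcaveOn ℝ Set.univ
        (fun s => φ s - (p - 1) * (∑ i, (|z i| / b i) ^ p) ^ (2 / p) / (2 * β) * s ^ 2) := by
  refine ⟨_, fun s => conjugate_weighted_lp hpq hβ hb fun i hi => by simp [hθ i hi, hz i hi], ?_⟩
  have h := (Real.concaveOn_sum_rpow_sub hp (fun i => θ i / b i) (fun i => z i / b i)).smul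
    (by positivity : 0 ≤ 1 / (2 * β))
  refine h.congr fun s _ => ?_
  have e1 : ∀ i, |θ i / b i + s * (z i / b i)| = |(θ + s • z) i| / b i := fun i => by
    rw [← abs_of_nonneg (hb i), ← abs_div, abs_of_nonneg (hb i)]
    simp only [PiLp.add_apply, PiLp.smul_apply, smul_eq_mul]
    congr 1; ring
  have e2 : ∀ i, |z i / b i| = |z i| / b i := fun i => by rw [abs_div, abs_of_nonneg (hb i)]
  simp only [e1, e2, smul_eq_mul]
  ring

end Conjugates

end OMD

namespace OMD

/-! ### Exponents and feature scales -/

section Features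

variable {d : ℕ} (x : ℕ → EuclideanSpace ℝ (Fin d))

theorem b_nonneg (t : ℕ) (i : Fin d) : 0 ≤ b x t i := NNReal.coe_nonneg _

theorem abs_le_b {s t : ℕ} (hs : s ∈ Finset.Icc 1 t) (i : Fin d) : |x s i| ≤ b x t i := by
  have : ‖x s i‖₊ ≤ (Finset.Icc 1 t).sup fun s => ‖x s i‖₊ :=
    Finset.le_sup (f := fun s => ‖x s i‖₊) hs
  exact_mod_cast this

theorem b_mono {s t : ℕ} (hst : s ≤ t) (i : Fin d) : b x s i ≤ b x t i :=
  NNReal.coe_le_coe.mpr (Finset.sup_mono (Finset.Icc_subset_Icc_right hst))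

theorem m_mono : Monotone (m x) := fun _ _ hst =>
  Finset.sup_mono (Finset.Icc_subset_Icc_right hst)

theorem card_le_m {t : ℕ} (ht : 1 ≤ t) :
    (Finset.univ.filter fun i => x t i ≠ 0).card ≤ m x t :=
  Finset.le_sup (f := fun s => (Finset.univ.filter fun i => x s i ≠ 0).card)
    (Finset.mem_Icc.mpr ⟨ht, le_rfl⟩)

/-- From `q = 1 + 1 / (p - 1)`, `q > 1` forces `p > 1`, and then `q ≤ 2` forces `p ≥ 2`, that is
`log m ≥ 1`, whereas `log 2 < 1`. The degenerate case `p = 1` has `q = 0` by the division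
convention. -/
theorem three_le_m {t : ℕ} (h : q x t ∈ Set.Ioc 1 2) : 3 ≤ m x t := by
  obtain ⟨h1, h2⟩ := h
  have hp1 : 0 < p x t - 1 := by
    by_contra hle
    have hq : q x t = 1 + 1 / (p x t - 1) ∨ q x t = 0 := by
      rcases eq_or_ne (p x t - 1) 0 with h0 | h0
      · right; simp [q, h0]
      · left; rw [q]; field_simp; ring
    have : 1 / (p x t - 1) ≤ 0 := one_div_nonpos.mpr (not_lt.mp hle)
    rcases hq with hq | hq <;> linarith
  have hp2 : 2 ≤ p x t := by
    rw [q, div_le_iff₀ hp1] at h2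
    linarith
  have hlog : 1 ≤ Real.log (m x t) := by rw [p] at hp2; linarith
  by_contra hlt
  have hm : m x t ≤ 2 := by omega
  have : Real.log (m x t) ≤ Real.log 2 := by
    rcases Nat.eq_zero_or_pos (m x t) with h0 | h0
    · rw [h0]; simpa using (Real.log_pos one_lt_two).le
    · exact Real.log_le_log (by exact_mod_cast h0) (by exact_mod_cast hm)
  linarith [Real.log_two_lt_d9]

/-- Since `e < 3`, the inequality is strict, as the smoothness of the squared `ℓ^p` norm requires.
-/
theorem two_lt_p {t : ℕ} (h : 3 ≤ m x t) : 2 < p x t := by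
  have h3 : (3 : ℝ) ≤ m x t := by exact_mod_cast h
  have : 1 < Real.log (m x t) := by
    rw [Real.lt_log_iff_exp_lt (by linarith)]
    linarith [Real.exp_one_lt_three]
  rw [p]; linarith

theorem p_le_p {s t : ℕ} (hst : s ≤ t) (h : 3 ≤ m x s) : p x s ≤ p x t := by
  have h1 : (0 : ℝ) < m x s := by exact_mod_cast (by omega : 0 < m x s)
  have h2 : (m x s : ℝ) ≤ m x t := by exact_mod_cast m_mono x hst
  have := Real.log_le_log h1 h2
  rw [p, p]; linarith

theorem holderConjugate_p_q {t : ℕ} (h : 2 < p x t) : (p x t).HolderConjugate (q x t) :=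
  Real.HolderConjugate.conjExponent (by linarith)

/-- The reason for the choice `p = 2 log m`, and the source of the constant `e` in the bound. -/
theorem m_rpow {t : ℕ} (h : 3 ≤ m x t) : (m x t : ℝ) ^ (2 / p x t) = Real.exp 1 := by
  have hm : (0 : ℝ) < m x t := by exact_mod_cast (by omega : 0 < m x t)
  have hp := two_lt_p x h
  rw [p] at hp
  rw [Real.rpow_def_of_pos hm, p]
  congr 1
  have : Real.log (m x t) ≠ 0 := by intro h0; rw [h0] at hp; linarith
  field_simp

theorem q_le_q {s t : ℕ} (hst : s ≤ t) (h : 3 ≤ m x s) : q x t ≤ q x s := by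
  have h1 := two_lt_p x h
  have h2 := p_le_p x hst h
  rw [q, q, div_le_div_iff₀ (by linarith) (by linarith)]
  nlinarith

end Features

/-! ### Subgradients of the losses -/

section Losses

variable {d : ℕ} {ℓ : ℝ → ℝ → ℝ} {x : ℕ → EuclideanSpace ℝ (Fin d)} {y : ℕ → ℝ} {t : ℕ}
  {g w : EuclideanSpace ℝ (Fin d)}

theorem loss_add_inner_le (hg : g ∈ subdifferential (fun v => (loss ℓ x y t v : EReal)) w)
    (u : EuclideanSpace ℝ (Fin d)) : loss ℓ x y t w + inner ℝ (u - w) g ≤ loss ℓ x y t u := by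
  have h : (loss ℓ x y t w : EReal) + ((inner ℝ (u - w) g : ℝ) : EReal) ≤ loss ℓ x y t u :=
    hg.2.2 u
  exact_mod_cast h

/-- Moving `w` by `±1` along coordinate `i` changes the linear prediction by `±x t i`, so the loss
grows by at most `L * |x t i|`, and by at least `±g i`. -/
theorem abs_subgradient_le {L : ℝ≥0} (hL : ∀ a : ℝ, LipschitzWith L (fun r : ℝ => ℓ r a))
    (hg : g ∈ subdifferential (fun v => (loss ℓ x y t v : EReal)) w) (i : Fin d) :
    |g i| ≤ L * |x t i| := by
  have key : ∀ c : ℝ, |c| = 1 → c * g i ≤ L * |x t i| := fun c hc => by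
    have h1 := loss_add_inner_le hg (w + EuclideanSpace.single i c)
    have h2 := (hL (y t)).dist_le_mul (inner ℝ (w + EuclideanSpace.single i c) (x t))
      (inner ℝ w (x t))
    rw [Real.dist_eq, Real.dist_eq, inner_add_left, add_sub_cancel_left] at h2
    rw [add_sub_cancel_left] at h1
    simp only [EuclideanSpace.inner_single_left, conj_trivial, abs_mul, hc, one_mul] at h1 h2
    have h3 := (le_abs_self _).trans h2
    simp only [loss, inner_add_left, EuclideanSpace.inner_single_left, conj_trivial] at h1
    linarith
  rw [abs_le]
  have h1 := key 1 (by simp)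
  have h2 := key (-1) (by simp)
  constructor <;> linarith

end Losses

/-! ### The two regret bounds -/

section Regret

variable {d : ℕ} {L : ℝ≥0} {η : ℝ} {ℓ : ℝ → ℝ → ℝ} {x : ℕ → EuclideanSpace ℝ (Fin d)} {y : ℕ → ℝ}
  {T : ℕ} {w θ g : ℕ → EuclideanSpace ℝ (Fin d)}

theorem regret_le_sum_inner
    (hg : ∀ t ∈ Finset.Icc 1 T, g t ∈ subdifferential (fun v => (loss ℓ x y t v : EReal)) (w t))
    (hη : 0 < η) (u : EuclideanSpace ℝ (Fin d)) :
    η * regret ℓ x y w T u ≤ ∑ t ∈ Finset.Icc 1 T, inner ℝ (u - w t) (-(η • g t)) := by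
  rw [regret, ← Finset.sum_sub_distrib, Finset.mul_sum]
  refine Finset.sum_le_sum fun t ht => ?_
  rw [inner_neg_right, real_inner_smul_right, ← mul_neg]
  exact mul_le_mul_of_nonneg_left (by linarith [loss_add_inner_le (hg t ht) u]) hη.le

/-- States and gradients vanish along the features that were always zero so far. -/
theorem IsRun.eq_zero_of_b_eq_zero {f : ℕ → EuclideanSpace ℝ (Fin d) → ℝ}
    (h : IsRun f (fun t => -(η • g t)) T θ w)
    (hgx : ∀ t ∈ Finset.Icc 1 T, ∀ i, |g t i| ≤ L * |x t i|) {t : ℕ} (ht : t ∈ Finset.Icc 1 T)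
    {i : Fin d} (hb : b x t i = 0) : θ t i = 0 := by
  obtain ⟨h1, hT⟩ := Finset.mem_Icc.mp ht
  have : ∀ s, 1 ≤ s → s ≤ t → θ s i = 0 := by
    intro s hs
    induction s, hs using Nat.le_induction with
    | base => intro _; rw [h.init]; rfl
    | succ s hs ih =>
      intro hst
      have hsT : s ∈ Finset.Icc 1 T := by simp; omega
      have hx : |x s i| ≤ b x t i := abs_le_b x (by simp; omega) i
      have hgs := hgx s hsT i
      rw [hb] at hx
      have : |g s i| ≤ 0 := hgs.trans (by
        rw [le_antisymm hx (abs_nonneg _), mul_zero])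
      have hg0 : g s i = 0 := abs_nonpos_iff.mp this
      rw [h.update s hsT, PiLp.add_apply, ih (by omega)]
      simp [hg0]
  exact this t h1 le_rfl

theorem abs_div_b_le (hgx : ∀ t ∈ Finset.Icc 1 T, ∀ i, |g t i| ≤ L * |x t i|) {t : ℕ}
    (ht : t ∈ Finset.Icc 1 T) (i : Fin d) : |g t i| / b x t i ≤ L := by
  have hb : |x t i| ≤ b x t i := abs_le_b x (by simp at ht ⊢; omega) i
  refine div_le_of_le_mul₀ (b_nonneg x t i) L.coe_nonneg ?_
  exact (hgx t ht i).trans (mul_le_mul_of_nonneg_left hb L.coe_nonneg)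

theorem eq_zero_of_b_eq_zero (hgx : ∀ t ∈ Finset.Icc 1 T, ∀ i, |g t i| ≤ L * |x t i|) {t : ℕ}
    (ht : t ∈ Finset.Icc 1 T) {i : Fin d} (hb : b x t i = 0) : g t i = 0 := by
  have hx : |x t i| ≤ b x t i := abs_le_b x (by simp at ht ⊢; omega) i
  rw [hb] at hx
  have := hgx t ht i
  rw [le_antisymm hx (abs_nonneg _), mul_zero] at this
  exact abs_nonpos_iff.mp this

/-- At most `m x t` ratios are nonzero and each is at most `L`; `m_rpow` turns their number into
`e`. This is what gives `A t ≤ K t` below. -/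
theorem sum_abs_div_b_rpow_le (hgx : ∀ t ∈ Finset.Icc 1 T, ∀ i, |g t i| ≤ L * |x t i|) {t : ℕ}
    (ht : t ∈ Finset.Icc 1 T) (hm : 3 ≤ m x t) :
    (∑ i, (|g t i| / b x t i) ^ p x t) ^ (2 / p x t) ≤ Real.exp 1 * (L : ℝ) ^ 2 := by
  have hp := two_lt_p x hm
  have hnn : ∀ i, 0 ≤ |g t i| / b x t i := fun i => div_nonneg (abs_nonneg _) (b_nonneg x t i)
  have hle : ∑ i, (|g t i| / b x t i) ^ p x t ≤ m x t * (L : ℝ) ^ p x t := by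
    calc ∑ i, (|g t i| / b x t i) ^ p x t
        = ∑ i ∈ Finset.univ.filter (fun i => x t i ≠ 0), (|g t i| / b x t i) ^ p x t := by
          refine (Finset.sum_filter_of_ne (p := fun i => x t i ≠ 0) fun i _ hne hx =>
            hne ?_).symm
          have := hgx t ht i
          rw [hx, abs_zero, mul_zero] at this
          rw [le_antisymm this (abs_nonneg _), zero_div, Real.zero_rpow (by linarith)]
      _ ≤ ∑ i ∈ Finset.univ.filter (fun i => x t i ≠ 0), (L : ℝ) ^ p x t :=
          Finset.sum_le_sum fun i _ =>
            Real.rpow_le_rpow (hnn i) (abs_div_b_le hgx ht i) (by linarith)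
      _ ≤ _ := by
          rw [Finset.sum_const, nsmul_eq_mul]
          refine mul_le_mul_of_nonneg_right ?_ (Real.rpow_nonneg L.coe_nonneg _)
          exact_mod_cast card_le_m x (Finset.mem_Icc.mp ht).1
  refine (Real.rpow_le_rpow (Finset.sum_nonneg fun i _ => Real.rpow_nonneg (hnn i) _) hle
    (by positivity)).trans_eq ?_
  rw [Real.mul_rpow (by positivity) (Real.rpow_nonneg L.coe_nonneg _), m_rpow x hm,
    ← Real.rpow_mul L.coe_nonneg, mul_div_cancel₀ _ (by linarith), Real.rpow_two]

theorem regret_le_reg₁ (hη : 0 < η) (hT : 1 ≤ T) (hL0 : 0 < (L : ℝ))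
    (hg : ∀ t ∈ Finset.Icc 1 T, g t ∈ subdifferential (fun v => (loss ℓ x y t v : EReal)) (w t))
    (hgx : ∀ t ∈ Finset.Icc 1 T, ∀ i, |g t i| ≤ L * |x t i|)
    (hq : ∀ t ∈ Finset.Icc 1 T, q x t ∈ Set.Ioc 1 2)
    (h : IsRun (reg₁ L x g) (fun t => -(η • g t)) T θ w) (u : EuclideanSpace ℝ (Fin d)) :
    regret ℓ x y w T u ≤ L * √(Real.exp 1 * (T + 1) * (2 * Real.log (m x T) - 1)) *
      (1 / (2 * η) * (∑ i, |u i| * b x T i) ^ 2 + η) := by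
  have hm : ∀ t ∈ Finset.Icc 1 T, 3 ≤ m x t := fun t ht => three_le_m x (hq t ht)
  have hp : ∀ t ∈ Finset.Icc 1 T, 2 < p x t := fun t ht => two_lt_p x (hm t ht)
  have hTT : T ∈ Finset.Icc 1 T := by simpa using hT
  set A : ℕ → ℝ := fun t =>
    (p x t - 1) * (∑ i, (|g t i| / b x t i) ^ p x t) ^ (2 / p x t) with hA
  set K : ℕ → ℝ := fun t => Real.exp 1 * (L : ℝ) ^ 2 * (p x t - 1) with hK
  have hβ : ∀ t, β L x g t = √(K t + ∑ s ∈ Finset.Ico 1 t, A s) := fun t => rfl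
  have hA0 : ∀ t ∈ Finset.Icc 1 T, 0 ≤ A t := fun t ht => by
    have := hp t ht
    exact mul_nonneg (by linarith) (Real.rpow_nonneg (Finset.sum_nonneg fun i _ =>
      Real.rpow_nonneg (div_nonneg (abs_nonneg _) (b_nonneg x t i)) _) _)
  have hAK : ∀ t ∈ Finset.Icc 1 T, A t ≤ K t := fun t ht => by
    have := mul_le_mul_of_nonneg_left (sum_abs_div_b_rpow_le hgx ht (hm t ht))
      (by linarith [hp t ht] : 0 ≤ p x t - 1)
    simp only [hA, hK]; linarith
  have hK0 : ∀ t ∈ Finset.Icc 1 T, 0 < K t := fun t ht => by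
    have : 0 < p x t - 1 := by linarith [hp t ht]
    positivity
  have hKmono : ∀ s ∈ Finset.Icc 1 T, ∀ t ∈ Finset.Icc 1 T, s ≤ t → K s ≤ K t :=
    fun s hs t _ hst => mul_le_mul_of_nonneg_left
      (by linarith [p_le_p x hst (hm s hs)]) (by positivity)
  have hIco : ∀ t ∈ Finset.Icc 1 T, ∀ s ∈ Finset.Ico 1 t, s ∈ Finset.Icc 1 T :=
    fun t ht s hs => by simp at ht hs ⊢; omega
  have hsum0 : ∀ t ∈ Finset.Icc 1 T, 0 ≤ ∑ s ∈ Finset.Ico 1 t, A s := fun t ht =>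
    Finset.sum_nonneg fun s hs => hA0 s (hIco t ht s hs)
  have hβ0 : ∀ t ∈ Finset.Icc 1 T, 0 < β L x g t := fun t ht =>
    Real.sqrt_pos.mpr (by linarith [hK0 t ht, hsum0 t ht] : 0 < K t + ∑ s ∈ Finset.Ico 1 t, A s)
  have hnn : ∀ t i, ∀ v : EuclideanSpace ℝ (Fin d), 0 ≤ |v i| * b x t i := fun t i v =>
    mul_nonneg (abs_nonneg _) (b_nonneg x t i)
  -- The smoothness constant of the conjugate in the direction `-(η • g t)`.
  have hmain := h.sum_inner_le hT (c := fun t => η ^ 2 / 2 * (A t / β L x g t))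
    (fun v => ?_) (fun t ht v => ?_) (fun t ht => ?_) u
  · have h1 := regret_le_sum_inner hg hη u
    rw [← Finset.mul_sum] at hmain
    have h2 : ∑ t ∈ Finset.Icc 1 T, A t / β L x g t ≤ 2 * √(∑ t ∈ Finset.Icc 1 T, A t) :=
      Finset.sum_div_sqrt_le A K T hA0 hAK
    set Q : ℝ := Real.exp 1 * (T + 1) * (2 * Real.log (m x T) - 1) with hQ
    have hKT : K T = Real.exp 1 * (L : ℝ) ^ 2 * (2 * Real.log (m x T) - 1) := rfl
    have hLQ : (T + 1) * K T = (L : ℝ) ^ 2 * Q := by rw [hKT, hQ]; ring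
    have hsq : √((L : ℝ) ^ 2 * Q) = L * √Q := by
      rw [Real.sqrt_mul (sq_nonneg _), Real.sqrt_sq L.coe_nonneg]
    -- With the initial term `K T` inside `β`, this makes `(T + 1) * K T`, whence the `T + 1` in the
    -- bound.
    have hST : ∑ t ∈ Finset.Icc 1 T, A t ≤ T * K T := by
      have := Finset.sum_le_card_nsmul (Finset.Icc 1 T) A (K T) fun t ht =>
        (hAK t ht).trans (hKmono t ht T hTT (Finset.mem_Icc.mp ht).2)
      simpa using this
    have hsub : ∑ t ∈ Finset.Ico 1 T, A t ≤ ∑ t ∈ Finset.Icc 1 T, A t :=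
      Finset.sum_le_sum_of_subset_of_nonneg Finset.Ico_subset_Icc_self fun t ht _ => hA0 t ht
    have h3 : √(∑ t ∈ Finset.Icc 1 T, A t) ≤ L * √Q := by
      rw [← hsq]
      exact Real.sqrt_le_sqrt (by linarith [hK0 T hTT])
    have h4 : β L x g T ≤ L * √Q := by
      rw [← hsq, hβ]
      exact Real.sqrt_le_sqrt (by linarith [hK0 T hTT])
    have h5 : (∑ i, (|u i| * b x T i) ^ q x T) ^ (2 / q x T) ≤ (∑ i, |u i| * b x T i) ^ 2 := by
      have := Real.sum_rpow_rpow_antitone one_pos (hq T hTT).1.le (fun i => hnn T i u)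
      simpa using this
    have h6 : reg₁ L x g T u ≤ L * √Q / 2 * (∑ i, |u i| * b x T i) ^ 2 :=
      mul_le_mul (by linarith) h5 (Real.rpow_nonneg (Finset.sum_nonneg fun i _ =>
        Real.rpow_nonneg (hnn T i u) _) _) (by positivity)
    have h7 : η ^ 2 / 2 * ∑ t ∈ Finset.Icc 1 T, A t / β L x g t ≤ η ^ 2 * (L * √Q) := by
      have := mul_le_mul_of_nonneg_left (h2.trans (mul_le_mul_of_nonneg_left h3 two_pos.le))
        (by positivity : 0 ≤ η ^ 2 / 2)
      linarith
    refine le_of_mul_le_mul_left ?_ hη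
    have : η * (L * √Q * (1 / (2 * η) * (∑ i, |u i| * b x T i) ^ 2 + η)) =
        L * √Q / 2 * (∑ i, |u i| * b x T i) ^ 2 + η ^ 2 * (L * √Q) := by
      field_simp
    rw [this]
    linarith
  · exact mul_nonneg (div_nonneg (Real.sqrt_nonneg _) two_pos.le)
      (Real.rpow_nonneg (Finset.sum_nonneg fun i _ => Real.rpow_nonneg (hnn 1 i v) _) _)
  · have ht1 : t ∈ Finset.Icc 1 T := by simp at ht ⊢; omega
    have ht2 : t + 1 ∈ Finset.Icc 1 T := by simp at ht ⊢; omega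
    have hβm : β L x g t ≤ β L x g (t + 1) := by
      rw [hβ, hβ, Finset.sum_Ico_succ_top (Finset.mem_Icc.mp ht1).1]
      exact Real.sqrt_le_sqrt (by linarith [hA0 t ht1, hKmono t ht1 _ ht2 (Nat.le_succ t)])
    have hqt := (hq (t + 1) ht2).1
    -- All three ingredients push the regularizer up: `β` and `b` increase, while `q` decreases and
    -- the `ℓ^q` norm is antitone in `q`.
    refine mul_le_mul (by linarith) ?_ (Real.rpow_nonneg (Finset.sum_nonneg fun i _ =>
      Real.rpow_nonneg (hnn t i v) _) _) (by linarith [hβ0 _ ht2])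
    refine (Real.sum_rpow_rpow_antitone (by linarith)
      (q_le_q x (Nat.le_succ t) (hm t ht1)) fun i => hnn t i v).trans ?_
    refine Real.rpow_le_rpow (Finset.sum_nonneg fun i _ => Real.rpow_nonneg (hnn t i v) _)
      (Finset.sum_le_sum fun i _ => Real.rpow_le_rpow (hnn t i v) ?_ (by linarith))
      (div_nonneg two_pos.le (by linarith))
    exact mul_le_mul_of_nonneg_left (b_mono x (Nat.le_succ t) i) (abs_nonneg _)
  · obtain ⟨φ, hφ, hc⟩ := conjugate_weighted_lp_line (holderConjugate_p_q x (hp t ht)) (hp t ht)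
      (hβ0 t ht) (b_nonneg x t) (θ := θ t) (z := -(η • g t))
      (fun i hi => h.eq_zero_of_b_eq_zero hgx ht hi)
      (fun i hi => by simp [eq_zero_of_b_eq_zero hgx ht hi])
    refine ⟨φ, hφ, ?_⟩
    convert hc using 4
    have e : ∀ i, |(-(η • g t)) i| / b x t i = η * (|g t i| / b x t i) := fun i => by
      simp only [PiLp.neg_apply, PiLp.smul_apply, smul_eq_mul, abs_neg, abs_mul, abs_of_pos hη]
      ring
    have hg0 : ∀ i, 0 ≤ |g t i| / b x t i := fun i => div_nonneg (abs_nonneg _) (b_nonneg x t i)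
    simp only [e, Real.mul_rpow hη.le (hg0 _), ← Finset.mul_sum]
    rw [Real.mul_rpow (Real.rpow_nonneg hη.le _)
      (Finset.sum_nonneg fun i _ => Real.rpow_nonneg (hg0 i) _), ← Real.rpow_mul hη.le,
      mul_div_cancel₀ _ (by linarith [hp t ht]), Real.rpow_two]
    simp only [hA]
    have := (hβ0 t ht).ne'
    field_simp

theorem regret_le_reg₂ (hη : 0 < η) (hT : 1 ≤ T) (hL0 : 0 < (L : ℝ))
    (hg : ∀ t ∈ Finset.Icc 1 T, g t ∈ subdifferential (fun v => (loss ℓ x y t v : EReal)) (w t))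
    (hgx : ∀ t ∈ Finset.Icc 1 T, ∀ i, |g t i| ≤ L * |x t i|)
    (h : IsRun (reg₂ L x g) (fun t => -(η • g t)) T θ w) (u : EuclideanSpace ℝ (Fin d)) :
    regret ℓ x y w T u ≤
      L * √(d * (T + 1)) * (1 / (2 * η) * ∑ i, (u i * b x T i) ^ 2 + η) := by
  set r : ℕ → Fin d → ℝ := fun t i =>
    √((L : ℝ) ^ 2 + ∑ s ∈ Finset.Ico 1 t, (g s i / b x s i) ^ 2) with hr
  have hr0 : ∀ t i, 0 < r t i := fun t i => Real.sqrt_pos.mpr (by positivity)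
  have hb0 := b_nonneg x
  set a : ℕ → Fin d → ℝ := fun t i => √(d : ℝ) / 2 * (b x t i ^ 2 * r t i) with ha
  have ha0 : ∀ t i, 0 ≤ a t i := fun t i =>
    mul_nonneg (by positivity) (mul_nonneg (sq_nonneg _) (hr0 t i).le)
  have haz : ∀ t i, a t i = 0 → b x t i = 0 := fun t i hai => by
    have hd : 0 < √(d : ℝ) := Real.sqrt_pos.mpr (by exact_mod_cast i.pos)
    simpa [ha, hd.ne', (hr0 t i).ne'] using hai
  have hreg : ∀ t, reg₂ L x g t = fun v => ∑ i, a t i * v i ^ 2 := fun t => by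
    funext v
    rw [reg₂, Finset.mul_sum]
    refine Finset.sum_congr rfl fun i _ => ?_
    rw [mul_pow, sq_abs]
    simp only [ha, hr]; ring
  have hgL : ∀ t ∈ Finset.Icc 1 T, ∀ i, (g t i / b x t i) ^ 2 ≤ (L : ℝ) ^ 2 := fun t ht i => by
    rw [← sq_abs, abs_div, abs_of_nonneg (hb0 t i)]
    exact pow_le_pow_left₀ (div_nonneg (abs_nonneg _) (hb0 t i)) (abs_div_b_le hgx ht i) 2
  -- The constant is `∑ z i ^ 2 / (4 * a t i)` at `z = -(η • g t)`.
  have hmain := h.sum_inner_le hT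
    (c := fun t => η ^ 2 / (2 * √(d : ℝ)) * ∑ i, (g t i / b x t i) ^ 2 / r t i)
    (fun v => ?_) (fun t ht v => ?_) (fun t ht => ?_) u
  · have h1 := regret_le_sum_inner hg hη u
    rw [← Finset.mul_sum, Finset.sum_comm] at hmain
    have hsq : √((L : ℝ) ^ 2 * (T + 1)) = L * √(T + 1) := by
      rw [Real.sqrt_mul (sq_nonneg _), Real.sqrt_sq L.coe_nonneg]
    have hST : ∀ i, ∑ t ∈ Finset.Icc 1 T, (g t i / b x t i) ^ 2 ≤ T * (L : ℝ) ^ 2 := fun i => by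
      have := Finset.sum_le_card_nsmul (Finset.Icc 1 T) _ ((L : ℝ) ^ 2) fun t ht => hgL t ht i
      simpa using this
    have h3 : ∀ i, ∑ t ∈ Finset.Icc 1 T, (g t i / b x t i) ^ 2 / r t i ≤ 2 * (L * √(T + 1)) :=
      fun i => by
        refine (Finset.sum_div_sqrt_le (fun t => (g t i / b x t i) ^ 2) (fun _ => (L : ℝ) ^ 2) T
          (fun t _ => sq_nonneg _) fun t ht => hgL t ht i).trans ?_
        rw [← hsq]
        exact mul_le_mul_of_nonneg_left
          (Real.sqrt_le_sqrt (by linarith [hST i, sq_nonneg (L : ℝ)])) two_pos.le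
    have h4 : ∀ i, r T i ≤ L * √(T + 1) := fun i => by
      have hsub : ∑ t ∈ Finset.Ico 1 T, (g t i / b x t i) ^ 2 ≤
          ∑ t ∈ Finset.Icc 1 T, (g t i / b x t i) ^ 2 :=
        Finset.sum_le_sum_of_subset_of_nonneg Finset.Ico_subset_Icc_self fun t _ _ => sq_nonneg _
      rw [← hsq]
      exact Real.sqrt_le_sqrt (by linarith [hST i])
    have h6 : reg₂ L x g T u ≤ √(d : ℝ) / 2 * (L * √(T + 1)) * ∑ i, (u i * b x T i) ^ 2 := by
      rw [hreg, Finset.mul_sum]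
      refine Finset.sum_le_sum fun i _ => ?_
      have : a T i * u i ^ 2 = √(d : ℝ) / 2 * (u i * b x T i) ^ 2 * r T i := by
        simp only [ha]; ring
      rw [this]
      refine (mul_le_mul_of_nonneg_left (h4 i) (by positivity)).trans_eq (by ring)
    have h7 : η ^ 2 / (2 * √(d : ℝ)) *
        ∑ i, ∑ t ∈ Finset.Icc 1 T, (g t i / b x t i) ^ 2 / r t i ≤
        η ^ 2 * (√(d : ℝ) * (L * √(T + 1))) := by
      have h8 := Finset.sum_le_card_nsmul Finset.univ
        (fun i => ∑ t ∈ Finset.Icc 1 T, (g t i / b x t i) ^ 2 / r t i) _ fun i _ => h3 i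
      rw [Finset.card_univ, Fintype.card_fin, nsmul_eq_mul] at h8
      refine (mul_le_mul_of_nonneg_left h8 (by positivity)).trans_eq ?_
      -- The identity `d / √d = √d` also covers `d = 0`.
      calc η ^ 2 / (2 * √(d : ℝ)) * (d * (2 * (L * √(T + 1))))
          = η ^ 2 * (d / √(d : ℝ) * (L * √(T + 1))) := by ring
        _ = _ := by rw [Real.div_sqrt]
    rw [Real.sqrt_mul (Nat.cast_nonneg d)]
    refine le_of_mul_le_mul_left ?_ hη
    have : η * (L * (√(d : ℝ) * √(T + 1)) * (1 / (2 * η) * ∑ i, (u i * b x T i) ^ 2 + η)) =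
        √(d : ℝ) / 2 * (L * √(T + 1)) * ∑ i, (u i * b x T i) ^ 2 +
          η ^ 2 * (√(d : ℝ) * (L * √(T + 1))) := by
      field_simp
    rw [this]
    linarith
  · rw [hreg]
    exact Finset.sum_nonneg fun i _ => mul_nonneg (ha0 1 i) (sq_nonneg _)
  · have ht1 := (Finset.mem_Ico.mp ht).1
    rw [hreg, hreg]
    refine Finset.sum_le_sum fun i _ => mul_le_mul_of_nonneg_right ?_ (sq_nonneg _)
    refine mul_le_mul_of_nonneg_left (mul_le_mul ?_ ?_ (hr0 t i).le (sq_nonneg _)) (by positivity)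
    · exact pow_le_pow_left₀ (hb0 t i) (b_mono x (Nat.le_succ t) i) 2
    · refine Real.sqrt_le_sqrt ?_
      rw [Finset.sum_Ico_succ_top ht1]
      linarith [sq_nonneg (g t i / b x t i)]
  · obtain ⟨φ, hφ, hc⟩ := conjugate_weighted_sq_line (ha0 t) (θ := θ t) (z := -(η • g t))
      (fun i hi => h.eq_zero_of_b_eq_zero hgx ht (haz t i hi))
      (fun i hi => by simp [eq_zero_of_b_eq_zero hgx ht (haz t i hi)])
    refine ⟨φ, by rw [hreg]; exact hφ, ?_⟩
    convert hc using 4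
    rw [Finset.mul_sum]
    refine Finset.sum_congr rfl fun i _ => ?_
    simp only [PiLp.neg_apply, PiLp.smul_apply, smul_eq_mul, ha]
    ring

theorem regret_eq_zero (hL : ∀ a : ℝ, LipschitzWith 0 (fun r : ℝ => ℓ r a))
    (u : EuclideanSpace ℝ (Fin d)) : regret ℓ x y w T u = 0 := by
  rw [regret, ← Finset.sum_sub_distrib]
  refine Finset.sum_eq_zero fun t _ => ?_
  have := (hL (y t)).dist_le_mul (inner ℝ (w t) (x t)) (inner ℝ u (x t))
  rw [NNReal.coe_zero, zero_mul] at this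
  exact sub_eq_zero.mpr (dist_le_zero.mp this)

end Regret

end OMD

theorem theorem1 (d : ℕ) (L : ℝ≥0) (η : ℝ) (hη : 0 < η)
    (ℓ : ℝ → ℝ → ℝ) (hL : ∀ a : ℝ, LipschitzWith L (fun r : ℝ => ℓ r a))
    (x : ℕ → EuclideanSpace ℝ (Fin d)) (y : ℕ → ℝ) (T : ℕ) (hT : 1 ≤ T)
    (hconv : ∀ t ∈ Finset.Icc 1 T, ConvexOn ℝ Set.univ (OMD.loss ℓ x y t))
    -- the predictions, the states of the algorithm, and the subgradients of the losses
    (w θ g : ℕ → EuclideanSpace ℝ (Fin d))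
    (hg : ∀ t ∈ Finset.Icc 1 T,
      g t ∈ OMD.subdifferential (fun v => (OMD.loss ℓ x y t v : EReal)) (w t)) :
    ((∀ t ∈ Finset.Icc 1 T, OMD.q x t ∈ Set.Ioc 1 2) →
      OMD.IsRun (OMD.reg₁ L x g) (fun t => -(η • g t)) T θ w →
      ∀ u : EuclideanSpace ℝ (Fin d),
        OMD.regret ℓ x y w T u ≤
          L * √(Real.exp 1 * (T + 1) * (2 * Real.log (OMD.m x T) - 1)) *
            (1 / (2 * η) * (∑ i, |u i| * OMD.b x T i) ^ 2 + η)) ∧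
    (OMD.IsRun (OMD.reg₂ L x g) (fun t => -(η • g t)) T θ w →
      ∀ u : EuclideanSpace ℝ (Fin d),
        OMD.regret ℓ x y w T u ≤
          L * √(d * (T + 1)) * (1 / (2 * η) * ∑ i, (u i * OMD.b x T i) ^ 2 + η)) := by
  -- For `L = 0` the scaling factors may vanish and the conjugate formulas break down, but the
  -- losses are then constant and both sides are zero.
  rcases eq_or_ne L 0 with rfl | hL0
  · exact ⟨fun _ _ u => by rw [OMD.regret_eq_zero hL u]; simp,
      fun _ u => by rw [OMD.regret_eq_zero hL u]; simp⟩
  · have hL0 : 0 < (L : ℝ) := NNReal.coe_pos.mpr (pos_iff_ne_zero.mpr hL0)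
    have hgx : ∀ t ∈ Finset.Icc 1 T, ∀ i, |g t i| ≤ L * |x t i| := fun t ht i =>
      OMD.abs_subgradient_le hL (hg t ht) i
    exact ⟨fun hq h u => OMD.regret_le_reg₁ hη hT hL0 hg hgx hq h u,
      fun h u => OMD.regret_le_reg₂ hη hT hL0 hg hgx h u⟩
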